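/- Let $q \ge 5$ be a prime power, $2 \le m \le q+1$ and $4 \le k \le \frac{q+1}{2}$, and put $n = m(q-1)$. Then there is a quantum generalized Roth–Lempel (GRL) code with parameters $$[[\,m(q-1)+3,\; m(q-1)+3-2k,\; \ge k-1\,]]_q .$$ More precisely, there are pairwise distinct $\alpha_1,\dots,\alpha_n \in \mathbb{F}_{q^2}$, nonzero $v_1,\dots,v_n \in \mathbb{F}_{q^2}$ and a nonsingular $3\times 3$ matrix $A$ over $\mathbb{F}_{q^2}$ such that the code $\mathcal{C} \subseteq \mathbb{F}_{q^2}^{\,n+3}$ with the $k \times (n+3)$ generator matrix $$\left(\begin{array}{c|c} v_j\alpha_j^{\,i} & \begin{matrix} O \\ A \end{matrix}\end{array}\right)_{0\le i\le k-1,\ 1\le j\le n},$$ where $O$ is the $(k-3)\times 3$ zero matrix, has dimension $k$, has minimum Hamming distance at least $m(q-1)-k+2$, and is Hermitian self-orthogonal, that is, $\sum_i u_i c_i^{\,q} = 0$ for all $u, c \in \mathcal{C}$; and from $\mathcal{C}$ one obtains by the Hermitian stabilizer (CSS) construction a quantum code $\mathcal{Q} \subseteq (\mathbb{C}^q)^{\otimes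 (n+3)}$ with $\dim \mathcal{Q} = q^{\,n+3-2k}$ and minimum distance $d(\mathcal{Q}) \ge k-1$. Here $\omega$ is a primitive $p$-th root of unity, $p$ being the characteristic of $\mathbb{F}_q$, and for $a, b \in \mathbb{F}_q^{\,N}$ with $N = n+3$ one sets $X(a)Z(b)\,|x\rangle = \omega^{\mathrm{Tr}(b\cdot x)}|x+a\rangle$ for $x \in \mathbb{F}_q^{\,N}$, where $\mathrm{Tr}$ is the trace from $\mathbb{F}_q$ to $\mathbb{F}_p$. The errors are the operators $E = \omega^c X(a)Z(b)$ with $c \in \mathbb{Z}/p$; the weight of $E$ is the number of $i$ with $(a_i,b_i)\ne(0,0)$; $\mathcal{Q}$ detects $E$ if there is a scalar $r$ with $\langle \varphi, E\psi\rangle = r\langle\varphi,\psi\rangle$ for all $\varphi,\psi\in\mathcal{Q}$; and $d(\mathcal{Q}) = d$ means that $\mathcal{Q}$ detects all errors of weight less than $d$ but not all errors of weight $d$. The quantum code $\mathcal{Q}$ is obtained from $\mathcal{C}$ by the Hermitian stabilizer construction if, for some $\mathbb{F}_q$-basis $(e_0,e_1)$ of $\mathbb{F}_{q^2}$, it is a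 nonzero joint eigenspace of all operators $X(a)Z(b)$ with $a e_0 + b e_1 \in \mathcal{C}$. -/

import Mathlib

noncomputable section

namespace QuantumGRL

/-! ### Classical codes over a field -/

section Classical_codes

variable {K : Type*} [Field K]

/-- The `k × (n + s)` generator matrix `(G_k | O ; A)`: its left block has the rows
`(v_1 α_1^i, …, v_n α_n^i)` for `i = 0, …, k - 1`, its right block is zero in the first
`k - s` rows and equal to the `s × s` matrix `A` in the last `s` rows. -/
def grlMatrix {n s : ℕ} (k : ℕ) (α v : Fin n → K) (A : Matrix (Fin s) (Fin s) K) :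
    Matrix (Fin k) (Fin n ⊕ Fin s) K :=
  Matrix.of fun i j => match j with
    | Sum.inl t => v t * α t ^ (i : ℕ)
    | Sum.inr t => if h : k - s ≤ (i : ℕ) then A ⟨(i : ℕ) - (k - s), by omega⟩ t else 0

/-- `C` is a generalized Roth–Lempel code `GRL_k(α, v, A)` of length `n + s`, for some pairwise
distinct `α_1, …, α_n`, nonzero `v_1, …, v_n` and a nonsingular `s × s` matrix `A`. -/
def IsGRLCode (n s k : ℕ) (C : Submodule K (Fin n ⊕ Fin s → K)) : Prop :=
  s ≤ k ∧ k ≤ n ∧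
    ∃ (α v : Fin n → K) (A : Matrix (Fin s) (Fin s) K),
      Function.Injective α ∧ (∀ i, v i ≠ 0) ∧ A.det ≠ 0 ∧
        C = Submodule.span K (Set.range (grlMatrix k α v A))

variable {ι : Type*} [Fintype ι]

/-- The Hermitian dual `{u | ∑ i, u_i c_i^q = 0 for all c ∈ C}` of a code over a field
with `q ^ 2` elements. -/
def hermitianDual (q : ℕ) (C : Submodule K (ι → K)) : Submodule K (ι → K) where
  carrier := {u | ∀ c ∈ C, ∑ i, u i * c i ^ q = 0}
  add_mem' := by
    intro u w hu hw c hc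
    simp only [Pi.add_apply, add_mul, Finset.sum_add_distrib, hu c hc, hw c hc, add_zero]
  zero_mem' := by
    intro c _
    simp
  smul_mem' := by
    intro r u hu c hc
    simp only [Pi.smul_apply, smul_eq_mul, mul_assoc, ← Finset.mul_sum, hu c hc, mul_zero]

def IsHermitianSelfOrthogonal (q : ℕ) (C : Submodule K (ι → K)) : Prop :=
  C ≤ hermitianDual q C

open Classical in
/-- The minimum Hamming distance of the linear code `C` is at least `d`. -/
def MinDistGE (C : Submodule K (ι → K)) (d : ℕ) : Prop :=
  ∀ c ∈ C, c ≠ 0 → d ≤ hammingNorm c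

end Classical_codes

/-! ### Quantum codes

`F` is a finite field of characteristic `p` and `ω` a primitive `p`-th root of unity. The Hilbert
space of the qudits with labels in `ι` is the tensor product of copies of `ℂ^F`, one for each
`i : ι`. It is written in its orthonormal basis of product states `|x⟩`, `x : ι → F`. -/

section Quantum_codes

variable {F : Type*} [Field F] [Fintype F] {ι : Type*} [Fintype ι] [DecidableEq ι]
  (p : ℕ) [Fact p.Prime] [Algebra (ZMod p) F] (ω : ℂ)

/-- The Hilbert space `⨂_{i : ι} ℂ^F`. -/
abbrev QuditSpace (F ι : Type*) : Type _ := EuclideanSpace ℂ (ι → F)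

open Classical in
/-- The matrix of `X(a) : |x⟩ ↦ |x + a⟩`. -/
def shiftMatrix (a : F) : Matrix F F ℂ :=
  Matrix.of fun y x => if y = x + a then 1 else 0

open Classical in
/-- The matrix of `Z(b) : |x⟩ ↦ ω ^ Tr(b x) |x⟩`, where `Tr` is the trace from `F` to the
prime field. -/
def phaseMatrix (b : F) : Matrix F F ℂ :=
  Matrix.diagonal fun x => ω ^ (Algebra.trace (ZMod p) F (b * x)).val

/-- The matrix of the tensor product of the operators with matrices `M i`, in the basis of
product states. -/
def tensorMatrix (M : ι → Matrix F F ℂ) : Matrix (ι → F) (ι → F) ℂ :=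
  Matrix.of fun y x => ∏ i, M i (y i) (x i)

open Classical in
/-- The operator `X(a) Z(b)` on the Hilbert space of the qudits, where `X(a) = ⨂ X(a_i)` and
`Z(b) = ⨂ Z(b_i)`. -/
def pauliOp (a b : ι → F) : QuditSpace F ι →ₗ[ℂ] QuditSpace F ι :=
  Matrix.toEuclideanLin
    (tensorMatrix (fun i => shiftMatrix (a i)) * tensorMatrix (fun i => phaseMatrix p ω (b i)))

/-- The element `ω ^ c X(a) Z(b)` of the error group. -/
def errorOp (c : ZMod p) (a b : ι → F) : QuditSpace F ι →ₗ[ℂ] QuditSpace F ι :=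
  ω ^ c.val • pauliOp p ω a b

open Classical in
/-- The quantum weight of `ω ^ c X(a) Z(b)`. -/
def quantumWeight (a b : ι → F) : ℕ :=
  (Finset.univ.filter fun i => (a i, b i) ≠ ((0, 0) : F × F)).card

/-- The quantum code `Q` detects the error `E`: for some scalar `r`, one has `P E P = r P` where
`P` is the orthogonal projection onto `Q`. -/
def Detects (Q : Submodule ℂ (QuditSpace F ι)) (E : QuditSpace F ι →ₗ[ℂ] QuditSpace F ι) : Prop :=
  ∃ r : ℂ, ∀ φ ∈ Q, ∀ ψ ∈ Q, inner ℂ φ (E ψ) = r * inner ℂ φ ψ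

/-- `Q` has minimum distance `d`: it detects all errors of weight less than `d`, and fails to
detect some error of weight `d`. -/
def HasQuantumDist (Q : Submodule ℂ (QuditSpace F ι)) (d : ℕ) : Prop :=
  (∀ (c : ZMod p) (a b : ι → F), quantumWeight a b < d → Detects Q (errorOp p ω c a b)) ∧
    ∃ (c : ZMod p) (a b : ι → F), quantumWeight a b = d ∧ ¬ Detects Q (errorOp p ω c a b)

/-- `Q` is an `[[n, κ, d]]_q` quantum code, where `q` is the number of elements of `F`. -/
def IsQuantumCode (Q : Submodule ℂ (QuditSpace F ι)) (n κ d : ℕ) : Prop :=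
  Fintype.card ι = n ∧ Module.finrank ℂ Q = Fintype.card F ^ κ ∧ HasQuantumDist p ω Q d

/-- `Q` is a quantum (stabilizer) code constructed from the linear code `C` over the quadratic
extension `K` of `F`: identify `(a, b)` with the vector `(a_i e_0 + b_i e_1)_i` over `K` through a
basis `(e_0, e_1)` of `K` over `F`. Then `Q` is a nonzero joint eigenspace of the operators
`X(a) Z(b)` for which this vector lies in `C`, with `χ a b` the eigenvalue of `X(a) Z(b)`. -/
def IsStabilizerCodeOf {K : Type*} [Field K] [Algebra F K] (C : Submodule K (ι → K))
    (Q : Submodule ℂ (QuditSpace F ι)) : Prop :=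
  Q ≠ ⊥ ∧ ∃ (e : Module.Basis (Fin 2) F K) (χ : (ι → F) → (ι → F) → ℂ),
    ∀ ψ, ψ ∈ Q ↔ ∀ a b : ι → F, (fun i => a i • e 0 + b i • e 1) ∈ C →
      pauliOp p ω a b ψ = χ a b • ψ

end Quantum_codes

end QuantumGRL

end

/-! Write q for `Fintype.card F` and κ = k - 2. The evaluation points are the union of m distinct
cosets β_s Fˣ in Kˣ. The multipliers on β_s Fˣ are chosen with v^(q+1) = u_s N(β_s)^(-κ) x^(q-1-2κ),
which is possible because the norm K → F is surjective. The Hermitian product of rows i and l of the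
left block then contains the power sum of x^(q-1-2κ+i+l) over Fˣ, which vanishes unless i + l = 2κ
(`sum_coset_gram`). Since i, l ≤ κ + 1, only three antidiagonal entries survive, namely -V, -U, -V^q
with U = ∑ u_s and V = ∑ u_s β_s^(q-1). The weights u_s are picked so that U and V are nonzero
(`exists_weights`), and a nonsingular A with the opposite Gram matrix is written down
(`exists_matrix_gram`), so the rows become self-orthogonal.

The distances follow from counting zeros of polynomials and from independence of Vandermonde
columns, the block A costing or gaining only a bounded weight (`lt_hammingNorm_vecMul_grlMatrix`,
`eq_zero_of_grlMatrix_mulVec_eq_zero`).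

The quantum part is the stabilizer formalism. Self-orthogonality makes the operators attached to C
commute. Their joint eigenspace has the dimension given by a trace computation
(`exists_joint_eigenspace`). A low-weight error either anticommutes up to a phase with some
stabilizer and is detected, or lies in the Hermitian dual and is then trivial
(`exists_stabilizerCode`). -/

namespace QuantumGRL

/-! ### Commutation, traces and detection of the operators X(a)Z(b). -/

section Error_operators

variable {F : Type*} [Field F] [Fintype F] {ι : Type*} [Fintype ι] [DecidableEq ι]
  (p : ℕ) [Fact p.Prime] [Algebra (ZMod p) F] {ω : ℂ}

/-- The additive character `x ↦ ω ^ Tr x` of `F`. -/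
noncomputable def traceChar (F : Type*) [Field F] [Algebra (ZMod p) F]
    (hω : IsPrimitiveRoot ω p) : AddChar F ℂ :=
  (AddChar.zmodChar p hω.pow_eq_one).compAddMonoidHom (Algebra.trace (ZMod p) F).toAddMonoidHom

theorem traceChar_apply (hω : IsPrimitiveRoot ω p) (x : F) :
    traceChar p F hω x = ω ^ (Algebra.trace (ZMod p) F x).val := rfl

theorem traceChar_isPrimitive (hω : IsPrimitiveRoot ω p) : (traceChar p F hω).IsPrimitive := by
  refine AddChar.IsPrimitive.of_ne_one ?_
  have hne : Algebra.trace (ZMod p) F ≠ 0 := Algebra.trace_ne_zero (ZMod p) F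
  obtain ⟨a, ha⟩ := DFunLike.ne_iff.1 hne
  exact AddChar.ne_one_iff.2 ⟨a, fun hf => ha <|
    (AddChar.IsPrimitive.zmod_char_eq_one_iff p
      (AddChar.zmodChar_primitive_of_primitive_root p hω) _).mp hf⟩

theorem traceChar_norm (hω : IsPrimitiveRoot ω p) (x : F) : ‖traceChar p F hω x‖ = 1 := by
  rw [traceChar_apply, norm_pow, hω.norm'_eq_one (Fact.out : p.Prime).ne_zero, one_pow]

/-- The error operator `X(a) Z(b)` translates by `a` and multiplies by a character. -/
theorem pauliOp_apply (hω : IsPrimitiveRoot ω p) (a b : ι → F) (ψ : QuditSpace F ι) (y : ι → F) :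
    pauliOp p ω a b ψ y = traceChar p F hω (b ⬝ᵥ (y - a)) * ψ (y - a) := by
  classical
  have hphase : tensorMatrix (fun i => phaseMatrix p ω (b i)) =
      Matrix.diagonal fun x : ι → F => traceChar p F hω (b ⬝ᵥ x) := by
    ext y x
    rw [tensorMatrix, Matrix.of_apply]
    by_cases h : y = x
    · subst h
      simp only [phaseMatrix, Matrix.diagonal_apply_eq, ← traceChar_apply p hω, dotProduct]
      exact (map_prod (traceChar p F hω).toMonoidHom
        (fun i => Multiplicative.ofAdd (b i * y i)) Finset.univ).symm
    · obtain ⟨i, hi⟩ := Function.ne_iff.1 h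
      rw [Matrix.diagonal_apply_ne _ h]
      exact Finset.prod_eq_zero (Finset.mem_univ i) (Matrix.diagonal_apply_ne _ hi)
  have hshift (x : ι → F) : tensorMatrix (fun i => shiftMatrix (a i)) y x =
      if x = y - a then 1 else 0 := by
    simp only [tensorMatrix, shiftMatrix, Matrix.of_apply]
    split_ifs with h
    · subst h
      simp
    · obtain ⟨i, hi⟩ := Function.ne_iff.1 h
      refine Finset.prod_eq_zero (Finset.mem_univ i) (if_neg fun h' => hi ?_)
      simp [h']
  rw [pauliOp, hphase, Matrix.toLpLin_apply]
  simp only [Matrix.mulVec, dotProduct, Matrix.mul_diagonal, hshift]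
  simp

theorem pauliOp_mul (hω : IsPrimitiveRoot ω p) (a b a' b' : ι → F) :
    pauliOp p ω a b * pauliOp p ω a' b' =
      traceChar p F hω (b ⬝ᵥ a') • pauliOp p ω (a + a') (b + b') := by
  ext ψ y
  simp only [Module.End.mul_apply, LinearMap.smul_apply, PiLp.smul_apply, smul_eq_mul,
    pauliOp_apply p hω, ← mul_assoc, ← AddChar.map_add_eq_mul, sub_sub]
  congr 2
  simp only [add_dotProduct, dotProduct_sub, dotProduct_add]
  ring

theorem pauliOp_zero (hω : IsPrimitiveRoot ω p) :
    pauliOp p ω (0 : ι → F) 0 = LinearMap.id := by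
  ext ψ y
  simp [pauliOp_apply p hω]

/-- Error operators commute up to the character of the symplectic form. -/
theorem pauliOp_mul_comm (hω : IsPrimitiveRoot ω p) (a b a' b' : ι → F) :
    pauliOp p ω a b * pauliOp p ω a' b' =
      traceChar p F hω (b ⬝ᵥ a' - b' ⬝ᵥ a) • (pauliOp p ω a' b' * pauliOp p ω a b) := by
  rw [pauliOp_mul p hω, pauliOp_mul p hω, smul_smul, ← AddChar.map_add_eq_mul, sub_add_cancel,
    add_comm a, add_comm b]

/-- The operator permutes the coordinates and multiplies them by phases of modulus one. -/
theorem inner_pauliOp (hω : IsPrimitiveRoot ω p) (a b : ι → F) (φ ψ : QuditSpace F ι) :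
    inner ℂ (pauliOp p ω a b φ) (pauliOp p ω a b ψ) = inner ℂ φ ψ := by
  simp only [PiLp.inner_apply, pauliOp_apply p hω]
  refine (Fintype.sum_equiv (Equiv.subRight a) _ _ fun y => ?_)
  simp only [RCLike.inner_apply, map_mul, Equiv.subRight_apply]
  rw [mul_mul_mul_comm, Complex.mul_conj, Complex.normSq_eq_norm_sq, traceChar_norm]
  simp

/-- Orthogonality of the characters `x ↦ ω ^ Tr (b · x)`. -/
theorem sum_traceChar_dotProduct (hω : IsPrimitiveRoot ω p) {b : ι → F} (hb : b ≠ 0) :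
    ∑ x : ι → F, traceChar p F hω (b ⬝ᵥ x) = 0 := by
  obtain ⟨i, hi⟩ := Function.ne_iff.1 hb
  let f : (ι → F) →+ F := AddMonoidHom.mk' (fun x => b ⬝ᵥ x) fun x y => dotProduct_add b x y
  refine AddChar.sum_eq_zero_of_ne_one (ψ := (traceChar p F hω).compAddMonoidHom f) ?_
  obtain ⟨x, hx⟩ := AddChar.ne_one_iff.1 (traceChar_isPrimitive p hω hi)
  refine AddChar.ne_one_iff.2 ⟨Pi.single i x, ?_⟩
  simpa [f, AddChar.mulShift_apply] using hx

theorem trace_pauliOp (hω : IsPrimitiveRoot ω p) {a b : ι → F} (h : a ≠ 0 ∨ b ≠ 0) :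
    LinearMap.trace ℂ _ (pauliOp p ω a b) = 0 := by
  classical
  rw [LinearMap.trace_eq_matrix_trace ℂ (PiLp.basisFun 2 ℂ (ι → F)), Matrix.trace]
  simp only [Matrix.diag_apply, LinearMap.toMatrix_apply, PiLp.basisFun_repr, PiLp.basisFun_apply,
    pauliOp_apply p hω]
  by_cases ha : a = 0
  · subst ha
    simpa using sum_traceChar_dotProduct p hω (h.resolve_left (by simp))
  · refine Finset.sum_eq_zero fun x _ => ?_
    simp [ha]

/-- A function on `F ^ ι` whose Fourier coefficients all vanish is zero. -/
theorem eq_zero_of_sum_traceChar (hω : IsPrimitiveRoot ω p) (g : (ι → F) → ℂ)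
    (h : ∀ b : ι → F, ∑ x, traceChar p F hω (b ⬝ᵥ x) * g x = 0) (z : ι → F) : g z = 0 := by
  classical
  -- Fourier inversion: after exchanging the sums, orthogonality of characters isolates the term x =
  -- z.
  have key : ∑ b : ι → F, traceChar p F hω (-(b ⬝ᵥ z)) *
      ∑ x, traceChar p F hω (b ⬝ᵥ x) * g x = 0 := by simp [h]
  simp only [Finset.mul_sum, ← mul_assoc, ← AddChar.map_add_eq_mul] at key
  rw [Finset.sum_comm] at key
  simp only [← Finset.sum_mul] at key
  rw [Finset.sum_eq_single z] at key
  · simpa using key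
  · intro x _ hx
    have := sum_traceChar_dotProduct p hω (sub_ne_zero.2 hx)
    simp only [dotProduct_comm (x - z), dotProduct_sub] at this
    simp only [neg_add_eq_sub, this, zero_mul]
  · simp

/-- A code of dimension at least two fails to detect some error. -/
theorem exists_not_detects (hω : IsPrimitiveRoot ω p) (Q : Submodule ℂ (QuditSpace F ι))
    (hQ : 1 < Module.finrank ℂ Q) : ∃ a b : ι → F, ¬ Detects Q (pauliOp p ω a b) := by
  by_contra! hall
  let B := stdOrthonormalBasis ℂ Q
  let φ := B ⟨0, by omega⟩
  let ψ := B ⟨1, hQ⟩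
  have horth : inner ℂ (φ : QuditSpace F ι) (ψ : QuditSpace F ι) = 0 :=
    B.orthonormal.2 (by simp)
  have hφ : (φ : QuditSpace F ι) ≠ 0 := by simpa using B.orthonormal.ne_zero ⟨0, by omega⟩
  have hψ : (ψ : QuditSpace F ι) ≠ 0 := by simpa using B.orthonormal.ne_zero ⟨1, hQ⟩
  have hzero (a b : ι → F) : inner ℂ (φ : QuditSpace F ι) (pauliOp p ω a b ψ) = 0 := by
    obtain ⟨r, hr⟩ := hall a b
    rw [hr _ φ.2 _ ψ.2, horth, mul_zero]
  -- For fixed a, the products ⟨φ, X(a)Z(b)ψ⟩ are the Fourier coefficients in b of this function of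
  -- x. All of them vanish, so φ and ψ could not both be nonzero.
  have hprod (a x : ι → F) :
      (ψ : QuditSpace F ι) x * starRingEnd ℂ ((φ : QuditSpace F ι) (x + a)) = 0 := by
    refine eq_zero_of_sum_traceChar p hω
      (fun x => (ψ : QuditSpace F ι) x * starRingEnd ℂ ((φ : QuditSpace F ι) (x + a)))
      (fun b => ?_) x
    rw [← hzero a b, PiLp.inner_apply]
    refine Fintype.sum_equiv (Equiv.addRight a) _ _ fun y => ?_
    simp [pauliOp_apply p hω, mul_assoc]
  obtain ⟨x, hx⟩ : ∃ x, (ψ : QuditSpace F ι) x ≠ 0 := by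
    by_contra! h
    exact hψ (PiLp.ext h)
  obtain ⟨y, hy⟩ : ∃ y, (φ : QuditSpace F ι) y ≠ 0 := by
    by_contra! h
    exact hφ (PiLp.ext h)
  simpa [hx, hy] using hprod (y - x) x

theorem detects_smul {Q : Submodule ℂ (QuditSpace F ι)} {E : QuditSpace F ι →ₗ[ℂ] QuditSpace F ι}
    (h : Detects Q E) (c : ℂ) : Detects Q (c • E) := by
  obtain ⟨r, hr⟩ := h
  refine ⟨c * r, fun φ hφ ψ hψ => ?_⟩
  rw [LinearMap.smul_apply, inner_smul_right, hr φ hφ ψ hψ, mul_assoc]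

/-- If all errors of weight less than `δ` are detected and `Q` has dimension at least two, then
the minimum distance of `Q` exists and is at least `δ`. -/
theorem exists_hasQuantumDist (hω : IsPrimitiveRoot ω p) (Q : Submodule ℂ (QuditSpace F ι))
    (hQ : 1 < Module.finrank ℂ Q) {δ : ℕ}
    (hδ : ∀ a b : ι → F, quantumWeight a b < δ → Detects Q (pauliOp p ω a b)) :
    ∃ d, δ ≤ d ∧ HasQuantumDist p ω Q d := by
  classical
  have hex : ∃ d, ∃ a b : ι → F, quantumWeight a b = d ∧ ¬ Detects Q (pauliOp p ω a b) := by
    obtain ⟨a, b, hab⟩ := exists_not_detects p hω Q hQ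
    exact ⟨_, a, b, rfl, hab⟩
  refine ⟨Nat.find hex, ?_, fun c a b hab => ?_, ?_⟩
  · obtain ⟨a, b, hw, hab⟩ := Nat.find_spec hex
    by_contra! hlt
    exact hab (hδ a b (hw ▸ hlt))
  · by_contra hnot
    refine Nat.find_min hex hab ⟨a, b, rfl, fun h => hnot (detects_smul h _)⟩
  · obtain ⟨a, b, hw, hab⟩ := Nat.find_spec hex
    exact ⟨0, a, b, hw, by simpa [errorOp] using hab⟩

/-- An error that commutes with some stabilizer only up to a nontrivial phase is detected. -/
theorem detects_of_not_commute (hω : IsPrimitiveRoot ω p) (Q : Submodule ℂ (QuditSpace F ι))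
    {a b a' b' : ι → F} {c : ℂ} (hQ : ∀ ψ ∈ Q, pauliOp p ω a b ψ = c • ψ)
    (h : traceChar p F hω (b ⬝ᵥ a' - b' ⬝ᵥ a) ≠ 1) : Detects Q (pauliOp p ω a' b') := by
  refine ⟨0, fun φ hφ ψ hψ => ?_⟩
  rw [zero_mul]
  by_contra hne
  apply h
  have hφ0 : inner ℂ φ φ ≠ 0 := by
    intro h0
    rw [inner_self_eq_zero] at h0
    exact hne (by simp [h0])
  have hc : starRingEnd ℂ c * c = 1 := by
    have := inner_pauliOp p hω a b φ φ
    rw [hQ φ hφ, inner_smul_left, inner_smul_right, ← mul_assoc] at this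
    exact mul_right_cancel₀ hφ0 (this.trans (one_mul _).symm)
  -- Applying the stabilizer to both sides leaves the inner product unchanged, yet multiplies it by
  -- the phase, the eigenvalues cancelling by `hc`.
  have h1 := inner_pauliOp p hω a b φ (pauliOp p ω a' b' ψ)
  rw [← Module.End.mul_apply, pauliOp_mul_comm p hω, LinearMap.smul_apply, Module.End.mul_apply,
    hQ φ hφ, hQ ψ hψ, map_smul, inner_smul_left, inner_smul_right, inner_smul_right] at h1
  refine mul_right_cancel₀ hne ?_
  linear_combination h1 - (traceChar p F hω (b ⬝ᵥ a' - b' ⬝ᵥ a)) *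
    inner ℂ φ (pauliOp p ω a' b' ψ) * hc

end Error_operators

/-! ### Common eigenvectors and dimensions of joint eigenspaces. -/

section Joint_eigenspaces

/-- A commuting family of endomorphisms of a nonzero finite-dimensional space over an
algebraically closed field has a common eigenvector. -/
theorem exists_common_eigenvector {k V S : Type*} [Field k] [IsAlgClosed k] [AddCommGroup V]
    [Module k V] [FiniteDimensional k V] [Nontrivial V] (f : S → Module.End k V)
    (hf : ∀ s t, Commute (f s) (f t)) :
    ∃ v ≠ 0, ∃ χ : S → k, ∀ s, f s v = χ s • v := by
  -- On a minimal nonzero invariant subspace every operator is scalar, because its eigenspaces there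
  -- are again invariant under the family.
  obtain ⟨W, ⟨hW0, hW⟩, hmin⟩ := wellFounded_lt.has_min
    {W : Submodule k V | W ≠ ⊥ ∧ ∀ s, ∀ v ∈ W, f s v ∈ W} ⟨⊤, top_ne_bot, by simp⟩
  obtain ⟨v, hv, hv0⟩ := W.exists_mem_ne_zero_of_ne_bot hW0
  have hscalar (s : S) : ∃ c : k, f s v = c • v := by
    have : Nontrivial W := (Submodule.nontrivial_iff_ne_bot).2 hW0
    obtain ⟨c, hc⟩ := Module.End.exists_eigenvalue ((f s).restrict (hW s))
    obtain ⟨w, hw⟩ := hc.exists_hasEigenvector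
    refine ⟨c, ?_⟩
    have hmem : W ⊓ (f s).eigenspace c = W := by
      by_contra hne
      refine hmin (W ⊓ (f s).eigenspace c) ⟨fun hbot => ?_, fun t u hu => ⟨hW t u hu.1, ?_⟩⟩
        (lt_of_le_of_ne inf_le_left hne)
      · refine hw.2 (Subtype.ext ((Submodule.mem_bot k).1 (hbot ▸ ⟨w.2, ?_⟩)))
        exact Module.End.mem_eigenspace_iff.2 (congrArg Subtype.val hw.apply_eq_smul)
      · have hu2 := Module.End.mem_eigenspace_iff.1 hu.2
        refine Module.End.mem_eigenspace_iff.2 ?_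
        rw [← Module.End.mul_apply, (hf s t).eq, Module.End.mul_apply, hu2, map_smul]
    rw [← hmem] at hv
    exact Module.End.mem_eigenspace_iff.1 hv.2
  choose χ hχ using hscalar
  exact ⟨v, hv0, χ, hχ⟩

variable {F : Type*} [Field F] [Fintype F] {ι : Type*} [Fintype ι] [DecidableEq ι]
  (p : ℕ) [Fact p.Prime] [Algebra (ZMod p) F] {ω : ℂ}

/-- A finite group of pairwise commuting error operators, given by an injective homomorphism
`s ↦ (a s, b s)` from a finite abelian group `G`, has a joint eigenspace of dimension
`#F ^ #ι / #G`. -/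
theorem exists_joint_eigenspace (hω : IsPrimitiveRoot ω p) {G : Type*} [AddCommGroup G] [Fintype G]
    (a b : G →+ (ι → F)) (hinj : ∀ s, a s = 0 → b s = 0 → s = 0)
    (hcomm : ∀ s t, b s ⬝ᵥ a t = b t ⬝ᵥ a s) :
    ∃ (Q : Submodule ℂ (QuditSpace F ι)) (χ : G → ℂ), Q ≠ ⊥ ∧
      (∀ ψ, ψ ∈ Q ↔ ∀ s, pauliOp p ω (a s) (b s) ψ = χ s • ψ) ∧
      Module.finrank ℂ Q * Fintype.card G = Fintype.card F ^ Fintype.card ι := by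
  classical
  obtain ⟨v, hv0, χ, hχ⟩ := exists_common_eigenvector (fun s => pauliOp p ω (a s) (b s))
    fun s t => by
      change _ * _ = _ * _
      rw [pauliOp_mul_comm p hω, hcomm, sub_self, AddChar.map_zero_eq_one, one_smul]
  have hχmul (s t : G) : χ s * χ t = traceChar p F hω (b s ⬝ᵥ a t) * χ (s + t) := by
    have h := congrArg (fun E => E v) (pauliOp_mul p hω (a s) (b s) (a t) (b t))
    simp only [Module.End.mul_apply, LinearMap.smul_apply, ← map_add, hχ, map_smul, smul_smul] at h
    rw [mul_comm]
    exact smul_left_injective ℂ hv0 h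
  have hχ0 : χ 0 = 1 := by
    have h := hχ 0
    rw [map_zero, map_zero, pauliOp_zero p hω, LinearMap.id_apply] at h
    exact smul_left_injective ℂ hv0 (by simpa using h.symm)
  have hχne (s : G) : χ s ≠ 0 := by
    have h := hχmul s (-s)
    rw [add_neg_cancel, hχ0, mul_one] at h
    intro h0
    rw [h0, zero_mul] at h
    have := traceChar_norm p hω (b s ⬝ᵥ a (-s))
    rw [← h] at this
    simp at this
  -- The operators multiply only up to phases, and the eigenvalues χ carry the same phases
  -- (`hχmul`). Dividing by χ gives a genuine representation whose invariants are the eigenspace.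
  let ρ : Representation ℂ (Multiplicative G) (QuditSpace F ι) :=
    { toFun := fun s => (χ s.toAdd)⁻¹ • pauliOp p ω (a s.toAdd) (b s.toAdd)
      map_one' := by
        rw [toAdd_one, map_zero, map_zero, pauliOp_zero p hω, hχ0, inv_one, one_smul]
        rfl
      map_mul' := fun s t => by
        rw [smul_mul_smul_comm, pauliOp_mul p hω, smul_smul, toAdd_mul, map_add, map_add,
          ← mul_inv, hχmul, mul_inv_rev, mul_assoc, inv_mul_cancel₀, mul_one]
        intro h0
        have := traceChar_norm p hω (b s.toAdd ⬝ᵥ a t.toAdd)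
        simp [h0] at this }
  have hρ (s : G) : ρ (Multiplicative.ofAdd s) = (χ s)⁻¹ • pauliOp p ω (a s) (b s) := rfl
  have hmem (ψ) : ψ ∈ ρ.invariants ↔ ∀ s, pauliOp p ω (a s) (b s) ψ = χ s • ψ := by
    rw [Representation.mem_invariants, Multiplicative.forall]
    refine forall_congr' fun s => ?_
    rw [hρ, LinearMap.smul_apply, inv_smul_eq_iff₀ (hχne s)]
  refine ⟨ρ.invariants, χ, ?_, hmem, ?_⟩
  · intro hbot
    exact hv0 ((Submodule.mem_bot ℂ).1 (hbot ▸ (hmem v).2 hχ))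
  · have hcard : (Fintype.card (Multiplicative G) : ℂ) ≠ 0 := by
      exact_mod_cast Fintype.card_ne_zero
    have : Invertible (Fintype.card (Multiplicative G) : ℂ) := invertibleOfNonzero hcard
    -- The dimension of the invariants is the trace of the averaging projection, to which only the
    -- identity contributes.
    have htr := (Representation.isProj_averageMap ρ).trace
    have hav : ρ.averageMap =
        (Fintype.card (Multiplicative G) : ℂ)⁻¹ • ∑ s : Multiplicative G, ρ s := by
      simp [Representation.averageMap, GroupAlgebra.average, invOf_eq_inv]
    have hsum : ∑ s : Multiplicative G, LinearMap.trace ℂ _ (ρ s) =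
        (Fintype.card F : ℂ) ^ Fintype.card ι := by
      rw [Finset.sum_eq_single 1]
      · rw [map_one, LinearMap.trace_one, finrank_euclideanSpace, Fintype.card_fun, Nat.cast_pow]
      · intro s _ hs
        rw [← ofAdd_toAdd s, hρ, map_smul, trace_pauliOp p hω, smul_zero]
        by_contra! h
        exact hs (hinj _ h.1 h.2)
      · simp
    rw [hav, map_smul, map_sum, hsum, smul_eq_mul, inv_mul_eq_iff_eq_mul₀ hcard,
      Fintype.card_multiplicative] at htr
    rw [mul_comm]
    exact_mod_cast htr.symm

end Joint_eigenspaces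

/-! ### Frobenius and the alternating form on a quadratic extension. -/

section Quadratic_extension

variable {F K : Type*} [Field F] [Fintype F] [Field K] [Algebra F K]

theorem finite_of_finrank_eq_two (hK : Module.finrank F K = 2) : Finite K :=
  have : Module.Finite F K := Module.finite_of_finrank_eq_succ hK
  Module.finite_of_finite F

theorem natCard_eq_sq (hK : Module.finrank F K = 2) : Nat.card K = Fintype.card F ^ 2 := by
  have : Module.Finite F K := Module.finite_of_finrank_eq_succ hK
  rw [Module.natCard_eq_pow_finrank (K := F), hK, Nat.card_eq_fintype_card]

theorem pow_card_pow_card (hK : Module.finrank F K = 2) (x : K) :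
    (x ^ Fintype.card F) ^ Fintype.card F = x := by
  have := finite_of_finrank_eq_two hK
  have := Fintype.ofFinite K
  rw [← pow_mul, ← sq, ← natCard_eq_sq hK, Nat.card_eq_fintype_card, FiniteField.pow_card]

theorem exists_pow_card_ne_self (hK : Module.finrank F K = 2) :
    ∃ x : K, x ^ Fintype.card F ≠ x := by
  by_contra! h
  have hlt := Fintype.one_lt_card (α := F)
  have := finite_of_finrank_eq_two hK
  have := Fintype.ofFinite K
  have hle := Polynomial.card_le_degree_of_subset_roots (R := K) (Z := Finset.univ)
    (p := Polynomial.X ^ Fintype.card F - Polynomial.X) (fun x _ => by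
      rw [Polynomial.mem_roots (FiniteField.X_pow_card_sub_X_ne_zero K hlt)]
      simp [h x])
  rw [FiniteField.X_pow_card_sub_X_natDegree_eq K hlt, Finset.card_univ,
    ← Nat.card_eq_fintype_card, natCard_eq_sq hK] at hle
  nlinarith

/-- The symplectic form of the coordinates of two elements of a quadratic extension. -/
theorem mul_pow_card_sub (a b a' b' : F) (x y : K) :
    (a • x + b • y) * (a' • x + b' • y) ^ Fintype.card F -
      (a • x + b • y) ^ Fintype.card F * (a' • x + b' • y) =
    (a * b' - b * a') • (x * y ^ Fintype.card F - x ^ Fintype.card F * y) := by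
  have h (c d : F) : (c • x + d • y) ^ Fintype.card F =
      c • x ^ Fintype.card F + d • y ^ Fintype.card F := by
    simpa using map_add (FiniteField.frobeniusAlgHom F K) (c • x) (d • y)
  rw [h, h]
  simp only [Algebra.smul_def, map_sub, map_mul]
  ring

theorem basis_mul_pow_card_sub_ne_zero (hK : Module.finrank F K = 2)
    (e : Module.Basis (Fin 2) F K) :
    e 0 * e 1 ^ Fintype.card F - e 0 ^ Fintype.card F * e 1 ≠ 0 := by
  intro h0
  obtain ⟨x, hx⟩ := exists_pow_card_ne_self hK
  have hrepr (z : K) : z = e.repr z 0 • e 0 + e.repr z 1 • e 1 := by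
    rw [← Fin.sum_univ_two fun i => e.repr z i • e i, e.sum_repr]
  -- If the constant vanished, the pair (x, 1) would give x = x^q for an x outside F.
  have h := mul_pow_card_sub (e.repr x 0) (e.repr x 1) (e.repr 1 0) (e.repr 1 1) (e 0) (e 1)
  rw [h0, smul_zero, ← hrepr, ← hrepr, one_pow, mul_one, mul_one, sub_eq_zero] at h
  exact hx h.symm

end Quadratic_extension

/-! ### From Hermitian self-orthogonal codes to stabilizer codes. -/

section Stabilizer_codes

variable {F K : Type*} [Field F] [Fintype F] [Field K] [Algebra F K] {ι : Type*} [Fintype ι]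
  [DecidableEq ι] (p : ℕ) [Fact p.Prime] [Algebra (ZMod p) F] {ω : ℂ}

/-- A Hermitian product S is fixed by Frobenius exactly when S - S^q = 0; this difference is a fixed
multiple of the symplectic form. -/
theorem sum_mul_pow_card_sub (e : Module.Basis (Fin 2) F K) (a b a' b' : ι → F) :
    ∑ i, (a i • e 0 + b i • e 1) * (a' i • e 0 + b' i • e 1) ^ Fintype.card F -
      (∑ i, (a i • e 0 + b i • e 1) * (a' i • e 0 + b' i • e 1) ^ Fintype.card F) ^ Fintype.card F =
    (a ⬝ᵥ b' - b ⬝ᵥ a') • (e 0 * e 1 ^ Fintype.card F - e 0 ^ Fintype.card F * e 1) := by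
  have hK : Module.finrank F K = 2 := by simp [Module.finrank_eq_card_basis e]
  have h := map_sum (FiniteField.frobeniusAlgHom F K)
    (fun i => (a i • e 0 + b i • e 1) * (a' i • e 0 + b' i • e 1) ^ Fintype.card F) Finset.univ
  simp only [FiniteField.coe_frobeniusAlgHom] at h
  rw [h, ← Finset.sum_sub_distrib, dotProduct, dotProduct, ← Finset.sum_sub_distrib,
    Finset.sum_smul]
  refine Finset.sum_congr rfl fun i _ => ?_
  rw [mul_pow, pow_card_pow_card hK, mul_pow_card_sub]

/-- A Hermitian self-orthogonal code is self-orthogonal for the symplectic form. -/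
theorem dotProduct_eq_of_selfOrthogonal {C : Submodule K (ι → K)}
    (hC : IsHermitianSelfOrthogonal (Fintype.card F) C) (e : Module.Basis (Fin 2) F K)
    {a b a' b' : ι → F} (h : (fun i => a i • e 0 + b i • e 1) ∈ C)
    (h' : (fun i => a' i • e 0 + b' i • e 1) ∈ C) : a ⬝ᵥ b' = b ⬝ᵥ a' := by
  have hK : Module.finrank F K = 2 := by simp [Module.finrank_eq_card_basis e]
  have hsum := sum_mul_pow_card_sub e a b a' b'
  rw [hC h _ h', zero_pow Fintype.card_ne_zero, sub_zero] at hsum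
  exact sub_eq_zero.1
    ((smul_eq_zero.1 hsum.symm).resolve_right (basis_mul_pow_card_sub_ne_zero hK e))

/-- The trace-symplectic dual of a `K`-linear code is contained in its Hermitian dual. -/
theorem mem_hermitianDual_of_traceChar (hω : IsPrimitiveRoot ω p) {C : Submodule K (ι → K)}
    (e : Module.Basis (Fin 2) F K) {a b : ι → F}
    (h : ∀ a' b' : ι → F, (fun i => a' i • e 0 + b' i • e 1) ∈ C →
      traceChar p F hω (b' ⬝ᵥ a - b ⬝ᵥ a') = 1) :
    (fun i => a i • e 0 + b i • e 1) ∈ hermitianDual (Fintype.card F) C := by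
  have hK : Module.finrank F K = 2 := by simp [Module.finrank_eq_card_basis e]
  have hrepr (z : K) : e.repr z 0 • e 0 + e.repr z 1 • e 1 = z :=
    (Fin.sum_univ_two fun i => e.repr z i • e i).symm.trans (e.sum_repr z)
  have hzero (a' b' : ι → F) (hmem : (fun i => a' i • e 0 + b' i • e 1) ∈ C) :
      b' ⬝ᵥ a - b ⬝ᵥ a' = 0 := by
    by_contra hne
    -- C is stable under scalars μ of F, so the character is trivial on every multiple of the
    -- symplectic product.
    apply traceChar_isPrimitive p hω hne
    ext μ
    have hμ : (fun i => (μ • a') i • e 0 + (μ • b') i • e 1) ∈ C := by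
      have : (fun i => (μ • a') i • e 0 + (μ • b') i • e 1) =
          algebraMap F K μ • fun i => a' i • e 0 + b' i • e 1 := by
        ext i
        simp [Algebra.smul_def]
        ring
      rw [this]
      exact C.smul_mem _ hmem
    have := h _ _ hμ
    rwa [smul_dotProduct, dotProduct_smul, ← smul_sub, smul_eq_mul, mul_comm] at this
  have hfix (c : ι → K) (hc : c ∈ C) :
      (∑ i, (a i • e 0 + b i • e 1) * c i ^ Fintype.card F) ^ Fintype.card F =
        ∑ i, (a i • e 0 + b i • e 1) * c i ^ Fintype.card F := by
    have hsum := sum_mul_pow_card_sub e a b (fun i => e.repr (c i) 0) (fun i => e.repr (c i) 1)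
    simp only [hrepr] at hsum
    rw [dotProduct_comm a, hzero _ _ (by simpa only [hrepr] using hc), zero_smul] at hsum
    exact (sub_eq_zero.1 hsum).symm
  intro c hc
  -- The products with c and with x • c are both fixed by Frobenius, but differ by the factor x^q,
  -- which is not.
  obtain ⟨x, hx⟩ := exists_pow_card_ne_self hK
  have hxc := hfix _ (C.smul_mem x hc)
  have hmul : ∑ i, (a i • e 0 + b i • e 1) * (x • c) i ^ Fintype.card F =
      x ^ Fintype.card F * ∑ i, (a i • e 0 + b i • e 1) * c i ^ Fintype.card F := by
    rw [Finset.mul_sum]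
    refine Finset.sum_congr rfl fun i _ => ?_
    rw [Pi.smul_apply, smul_eq_mul, mul_pow]
    ring
  rw [hmul, mul_pow, pow_card_pow_card hK, hfix c hc] at hxc
  by_contra hne
  exact hx (mul_right_cancel₀ hne hxc).symm

/-- The Hermitian construction: a Hermitian self-orthogonal code of dimension less than half its
length gives a stabilizer code. -/
theorem exists_stabilizerCode (hK : Module.finrank F K = 2) (hω : IsPrimitiveRoot ω p)
    {C : Submodule K (ι → K)} (hC : IsHermitianSelfOrthogonal (Fintype.card F) C)
    (hdim : 2 * Module.finrank K C < Fintype.card ι) {δ : ℕ}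
    (hδ : MinDistGE (hermitianDual (Fintype.card F) C) δ) :
    ∃ Q : Submodule ℂ (QuditSpace F ι), IsStabilizerCodeOf p ω C Q ∧
      ∃ d, δ ≤ d ∧ IsQuantumCode p ω Q (Fintype.card ι)
        (Fintype.card ι - 2 * Module.finrank K C) d := by
  classical
  have hfin := finite_of_finrank_eq_two hK
  have := Fintype.ofFinite C
  let e := Module.finBasisOfFinrankEq F K hK
  have hrepr (z : K) : e.repr z 0 • e 0 + e.repr z 1 • e 1 = z :=
    (Fin.sum_univ_two fun i => e.repr z i • e i).symm.trans (e.sum_repr z)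
  have hcoord0 (x y : F) : e.repr (x • e 0 + y • e 1) 0 = x := by simp
  have hcoord1 (x y : F) : e.repr (x • e 0 + y • e 1) 1 = y := by simp
  let a : C →+ (ι → F) := AddMonoidHom.mk' (fun c i => e.repr (c.1 i) 0) fun c d => by ext; simp
  let b : C →+ (ι → F) := AddMonoidHom.mk' (fun c i => e.repr (c.1 i) 1) fun c d => by ext; simp
  have hab (c : C) : (fun i => a c i • e 0 + b c i • e 1) = c.1 := funext fun i => hrepr _
  have ha (x y : ι → F) (h : (fun i => x i • e 0 + y i • e 1) ∈ C) : a ⟨_, h⟩ = x :=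
    funext fun i => hcoord0 _ _
  have hb (x y : ι → F) (h : (fun i => x i • e 0 + y i • e 1) ∈ C) : b ⟨_, h⟩ = y :=
    funext fun i => hcoord1 _ _
  obtain ⟨Q, χ, hQ0, hQ, hcard⟩ := exists_joint_eigenspace p hω a b
    (fun s h0 h1 => by
      rw [← Subtype.coe_inj, ← hab, h0, h1]
      ext
      simp)
    (fun s t => by
      rw [dotProduct_comm (b t)]
      exact (dotProduct_eq_of_selfOrthogonal hC e ((hab s).symm ▸ s.2)
        ((hab t).symm ▸ t.2)).symm)
  have hfinrank : Module.finrank ℂ Q =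
      Fintype.card F ^ (Fintype.card ι - 2 * Module.finrank K C) := by
    have hcardC : Fintype.card C = Fintype.card F ^ (2 * Module.finrank K C) := by
      rw [← Nat.card_eq_fintype_card, Module.natCard_eq_pow_finrank (K := K), natCard_eq_sq hK,
        pow_mul]
    refine Nat.eq_of_mul_eq_mul_right (pow_pos (Fintype.card_pos (α := F)) (2 * Module.finrank K C)) ?_
    rw [← pow_add, Nat.sub_add_cancel hdim.le, ← hcardC, hcard]
  have hstab (ψ) (hψ : ψ ∈ Q) (x y : ι → F) (h : (fun i => x i • e 0 + y i • e 1) ∈ C) :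
      pauliOp p ω x y ψ = χ ⟨_, h⟩ • ψ := by
    have := (hQ ψ).1 hψ ⟨_, h⟩
    rwa [ha, hb] at this
  have hdet (x y : ι → F) (hw : quantumWeight x y < δ) : Detects Q (pauliOp p ω x y) := by
    by_cases h : ∀ x' y' : ι → F, (fun i => x' i • e 0 + y' i • e 1) ∈ C →
      traceChar p F hω (y' ⬝ᵥ x - y ⬝ᵥ x') = 1
    · have hdual := mem_hermitianDual_of_traceChar p hω e h
      have hli (i : ι) : x i • e 0 + y i • e 1 = 0 ↔ (x i, y i) = ((0, 0) : F × F) := by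
        refine ⟨fun h0 => ?_, fun h0 => ?_⟩
        · rw [← hcoord0 (x i) (y i), h0, ← hcoord1 (x i) (y i), h0]
          simp
        · rw [Prod.mk.injEq] at h0
          simp [h0]
      have hzero : (fun i => x i • e 0 + y i • e 1) = 0 := by
        by_contra hne
        refine absurd (hδ _ hdual hne) (not_le.2 (lt_of_eq_of_lt ?_ hw))
        simp [hammingNorm, quantumWeight, hli]
      have hx : x = 0 := funext fun i => congrArg Prod.fst ((hli i).1 (congrFun hzero i))
      have hy : y = 0 := funext fun i => congrArg Prod.snd ((hli i).1 (congrFun hzero i))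
      refine ⟨1, fun φ _ ψ _ => ?_⟩
      rw [hx, hy, pauliOp_zero p hω, LinearMap.id_apply, one_mul]
    · push Not at h
      obtain ⟨x', y', hmem, hne⟩ := h
      exact detects_of_not_commute p hω Q (fun ψ hψ => hstab ψ hψ x' y' hmem) hne
  obtain ⟨d, hd, hdist⟩ := exists_hasQuantumDist p hω Q
    (hfinrank ▸ Nat.one_lt_pow (by omega) Fintype.one_lt_card) hdet
  -- The value 0 off C is never used.
  refine ⟨Q, ⟨hQ0, e, fun x y => if h : _ then χ ⟨fun i => x i • e 0 + y i • e 1, h⟩ else 0,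
    fun ψ => ⟨fun hψ x y h => ?_, fun hψ => (hQ ψ).2 fun s => ?_⟩⟩, d, hd, rfl, hfinrank, hdist⟩
  · beta_reduce
    rw [dif_pos h, hstab ψ hψ x y h]
  · have hs : (fun i => a s i • e 0 + b s i • e 1) ∈ C := (hab s).symm ▸ s.2
    rw [hψ _ _ hs]
    beta_reduce
    rw [dif_pos hs]
    congr 2
    exact Subtype.ext (hab s)

end Stabilizer_codes

/-! ### Dimension, distance and dual distance of generalized Roth–Lempel codes. -/

section Generalized_Roth_Lempel_codes

variable {K : Type*} [Field K]

theorem hammingNorm_sum {α β : Type*} [Fintype α] [Fintype β] [DecidableEq K] (c : α ⊕ β → K) :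
    hammingNorm c = hammingNorm (fun i => c (Sum.inl i)) + hammingNorm fun i => c (Sum.inr i) := by
  simp only [hammingNorm, Finset.card_filter, Fintype.sum_sum_type]

theorem sum_dite_tail {s k : ℕ} (hs : s ≤ k) (g : Fin k → Fin s → K) :
    ∑ r : Fin k, (if h : k - s ≤ (r : ℕ) then g r ⟨(r : ℕ) - (k - s), by omega⟩ else 0) =
      ∑ i : Fin s, g ⟨k - s + i, by omega⟩ i := by
  obtain ⟨l, rfl⟩ := Nat.exists_eq_add_of_le' hs
  rw [Fin.sum_univ_add, Finset.sum_eq_zero, zero_add]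
  · simp
    rfl
  · intro i _
    rw [dif_neg]
    simp

theorem vecMul_grlMatrix_inl [DecidableEq K] {n s k : ℕ} (α v : Fin n → K) (A : Matrix (Fin s) (Fin s) K)
    (f : Fin k → K) (j : Fin n) :
    Matrix.vecMul f (grlMatrix k α v A) (Sum.inl j) = v j * (Polynomial.ofFn k f).eval (α j) := by
  rw [Polynomial.ofFn_eq_sum_monomial, Polynomial.eval_finsetSum, Finset.mul_sum]
  simp [Matrix.vecMul, dotProduct, grlMatrix, mul_left_comm]

theorem vecMul_grlMatrix_inr {n s k : ℕ} (hs : s ≤ k) (α v : Fin n → K)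
    (A : Matrix (Fin s) (Fin s) K) (f : Fin k → K) (t : Fin s) :
    Matrix.vecMul f (grlMatrix k α v A) (Sum.inr t) =
      Matrix.vecMul (fun i : Fin s => f ⟨k - s + i, by omega⟩) A t := by
  simp only [Matrix.vecMul, dotProduct]
  rw [← sum_dite_tail hs fun r i => f r * A i t]
  simp [grlMatrix]

/-- A generalized Reed–Solomon word of a nonzero polynomial of degree less than `d` has at most
`d - 1` zeros. -/
theorem lt_hammingNorm_eval_add [DecidableEq K] {n d : ℕ} {α v : Fin n → K}
    (hα : Function.Injective α) (hv : ∀ j, v j ≠ 0) {P : Polynomial K} (hP : P ≠ 0)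
    (hd : P.natDegree < d) : n < hammingNorm (fun j => v j * P.eval (α j)) + d := by
  have hzeros : (Finset.univ.filter fun j => P.eval (α j) = 0).card ≤ P.natDegree := by
    rw [← Finset.card_image_of_injective _ hα]
    refine Polynomial.card_le_degree_of_subset_roots fun x hx => ?_
    obtain ⟨j, hj, rfl⟩ := Finset.mem_image.1 (Finset.mem_def.2 hx)
    exact (Polynomial.mem_roots hP).2 (Finset.mem_filter.1 hj).2
  have hsplit := Finset.card_filter_add_card_filter_not (s := Finset.univ)
    (fun j => P.eval (α j) = 0)
  rw [Finset.card_univ, Fintype.card_fin] at hsplit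
  simp only [hammingNorm, ne_eq, mul_eq_zero, hv, false_or]
  omega

/-- If the top s coefficients vanish, the degree drops below k - s ≤ k - 1 and one zero is saved on
the left. Otherwise A is injective on them and the right block has positive weight. -/
theorem lt_hammingNorm_vecMul_grlMatrix [DecidableEq K] {n s k : ℕ} (hs : 1 ≤ s) (hsk : s ≤ k)
    {α v : Fin n → K} {A : Matrix (Fin s) (Fin s) K} (hα : Function.Injective α)
    (hv : ∀ j, v j ≠ 0) (hA : A.det ≠ 0) {f : Fin k → K} (hf : f ≠ 0) :
    n + 1 < hammingNorm (Matrix.vecMul f (grlMatrix k α v A)) + k := by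
  have hP : Polynomial.ofFn k f ≠ 0 := by
    rw [Ne, ← map_zero (Polynomial.ofFn k), (Polynomial.injective_ofFn k).eq_iff]
    exact hf
  rw [hammingNorm_sum]
  simp only [vecMul_grlMatrix_inl, vecMul_grlMatrix_inr hsk]
  by_cases htail : (fun i : Fin s => f ⟨k - s + i, by omega⟩) = 0
  · have hdeg : (Polynomial.ofFn k f).natDegree < k - s := by
      rw [← not_le]
      intro hle
      have hlt := Polynomial.ofFn_natDegree_lt (show 1 ≤ k by omega) f
      have hlead := Polynomial.leadingCoeff_ne_zero.2 hP
      rw [Polynomial.leadingCoeff, Polynomial.ofFn_coeff_eq_val_of_lt _ hlt] at hlead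
      refine hlead ?_
      have := congrFun htail ⟨(Polynomial.ofFn k f).natDegree - (k - s), by omega⟩
      simpa [Nat.add_sub_cancel' hle] using this
    have := lt_hammingNorm_eval_add hα hv hP hdeg
    omega
  · have hright : 0 < hammingNorm fun t => Matrix.vecMul
        (fun i : Fin s => f ⟨k - s + i, by omega⟩) A t :=
      hammingNorm_pos_iff.2 fun h0 => htail (Matrix.eq_zero_of_vecMul_eq_zero hA h0)
    have := lt_hammingNorm_eval_add hα hv hP
      (Polynomial.ofFn_natDegree_lt (show 1 ≤ k by omega) f)
    omega

theorem minDistGE_grl {n s k : ℕ} (hs : 1 ≤ s) (hsk : s ≤ k) (hkn : k ≤ n) {α v : Fin n → K}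
    {A : Matrix (Fin s) (Fin s) K} (hα : Function.Injective α) (hv : ∀ j, v j ≠ 0)
    (hA : A.det ≠ 0) :
    MinDistGE (Submodule.span K (Set.range (grlMatrix k α v A))) (n - k + 2) := by
  classical
  intro c hc hc0
  have hrange := range_vecMulLinear (grlMatrix k α v A)
  change _ = Submodule.span K (Set.range (grlMatrix k α v A)) at hrange
  rw [← hrange] at hc
  obtain ⟨f, rfl⟩ := hc
  have := lt_hammingNorm_vecMul_grlMatrix hs hsk hα hv hA (f := f) (by rintro rfl; simp at hc0)
  rw [Matrix.vecMulLinear_apply]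
  have hle : n - k + 2 ≤ hammingNorm (Matrix.vecMul f (grlMatrix k α v A)) := by omega
  convert! hle

theorem finrank_grl {n s k : ℕ} (hs : 1 ≤ s) (hsk : s ≤ k) (hkn : k ≤ n) {α v : Fin n → K}
    {A : Matrix (Fin s) (Fin s) K} (hα : Function.Injective α) (hv : ∀ j, v j ≠ 0)
    (hA : A.det ≠ 0) :
    Module.finrank K (Submodule.span K (Set.range (grlMatrix k α v A))) = k := by
  classical
  have hrange := range_vecMulLinear (grlMatrix k α v A)
  change _ = Submodule.span K (Set.range (grlMatrix k α v A)) at hrange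
  rw [← hrange, LinearMap.finrank_range_of_inj, Module.finrank_fin_fun]
  refine (injective_iff_map_eq_zero _).2 fun f hf => ?_
  by_contra hf0
  have := lt_hammingNorm_vecMul_grlMatrix hs hsk hα hv hA hf0
  rw [Matrix.vecMulLinear_apply] at hf
  rw [hf, hammingNorm_zero] at this
  omega

/-- Any `d` columns of a Vandermonde matrix with `d` rows are linearly independent. -/
theorem eq_zero_of_sum_mul_pow [DecidableEq K] {n d : ℕ} {α : Fin n → K}
    (hα : Function.Injective α) {y : Fin n → K} (hy : hammingNorm y ≤ d)
    (h : ∀ r < d, ∑ j, y j * α j ^ r = 0) : y = 0 := by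
  by_contra hne
  obtain ⟨j₀, hj₀⟩ := Function.ne_iff.1 hne
  let S := (Finset.univ.filter fun j => y j ≠ 0).erase j₀
  -- Pairing y with the polynomial that kills all support points except j₀ isolates y j₀.
  let P : Polynomial K := ∏ j ∈ S, (Polynomial.X - Polynomial.C (α j))
  have hS : S.card + 1 = hammingNorm y :=
    Finset.card_erase_add_one (Finset.mem_filter.2 ⟨Finset.mem_univ _, hj₀⟩)
  have hdeg : P.natDegree < d := by
    rw [Polynomial.natDegree_finsetProd_X_sub_C_eq_card]
    omega
  have hsum : ∑ j, y j * P.eval (α j) = 0 := by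
    simp only [Polynomial.eval_eq_sum_range' hdeg, Finset.mul_sum]
    rw [Finset.sum_comm]
    refine Finset.sum_eq_zero fun r hr => ?_
    simp only [mul_left_comm _ (P.coeff r)]
    rw [← Finset.mul_sum, h r (Finset.mem_range.1 hr), mul_zero]
  rw [Finset.sum_eq_single j₀] at hsum
  · refine mul_ne_zero hj₀ ?_ hsum
    rw [Polynomial.eval_prod]
    refine Finset.prod_ne_zero_iff.2 fun j hj => ?_
    simpa [sub_eq_zero, hα.eq_iff, eq_comm] using Finset.ne_of_mem_erase hj
  · intro j _ hj
    by_cases hyj : y j = 0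
    · rw [hyj, zero_mul]
    · rw [Polynomial.eval_prod, Finset.prod_eq_zero (i := j), mul_zero]
      · exact Finset.mem_erase.2 ⟨hj, Finset.mem_filter.2 ⟨Finset.mem_univ _, hyj⟩⟩
      · simp
  · simp

/-- Any `k - s + 1` columns of the generator matrix of a generalized Roth–Lempel code are linearly
independent. -/
theorem eq_zero_of_grlMatrix_mulVec_eq_zero [DecidableEq K] {n s k : ℕ} (hs : 1 ≤ s) (hsk : s ≤ k)
    {α v : Fin n → K} {A : Matrix (Fin s) (Fin s) K} (hα : Function.Injective α)
    (hv : ∀ j, v j ≠ 0) (hA : A.det ≠ 0) {w : Fin n ⊕ Fin s → K}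
    (hw : hammingNorm w < k - s + 2) (h : Matrix.mulVec (grlMatrix k α v A) w = 0) : w = 0 := by
  rw [hammingNorm_sum] at hw
  have hrow (r : ℕ) (hr : r < k) : ∑ j, w (Sum.inl j) * v j * α j ^ r +
      ∑ t, (if h : k - s ≤ r then A ⟨r - (k - s), by omega⟩ t else 0) * w (Sum.inr t) = 0 := by
    have := congrFun h ⟨r, hr⟩
    simpa [Matrix.mulVec, dotProduct, grlMatrix, Fintype.sum_sum_type, mul_comm, mul_assoc,
      mul_left_comm] using this
  have hnorm : hammingNorm (fun j => w (Sum.inl j) * v j) =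
      hammingNorm fun j => w (Sum.inl j) := by
    simp [hammingNorm, hv]
  have hleft (h0 : (fun j => w (Sum.inl j) * v j) = 0) (j : Fin n) : w (Sum.inl j) = 0 :=
    (mul_eq_zero.1 (congrFun h0 j)).resolve_right (hv j)
  by_cases hr0 : (fun t => w (Sum.inr t)) = 0
  · have hl0 := eq_zero_of_sum_mul_pow hα (y := fun j => w (Sum.inl j) * v j) (d := k)
      (by omega) fun r hr => by simpa [congrFun hr0 _] using hrow r hr
    ext (j | t)
    · exact hleft hl0 j
    · exact congrFun hr0 t
  -- One unit of weight lies on the right, leaving at most k - s on the left. The first k - s rows,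
  -- where the right block is zero, then force the left part to vanish, and A forces the right part.
  · have hpos := hammingNorm_pos_iff.2 hr0
    have hl0 := eq_zero_of_sum_mul_pow hα (y := fun j => w (Sum.inl j) * v j) (d := k - s)
      (by omega) fun r hr => by
        simpa [not_le.2 hr] using hrow r (by omega)
    refine absurd (Matrix.eq_zero_of_mulVec_eq_zero hA ?_) hr0
    ext i
    have := hrow (k - s + i) (by omega)
    simpa [hleft hl0, Matrix.mulVec, dotProduct] using this

variable {F : Type*} [Field F] [Fintype F] [Algebra F K]

/-- Raising coordinates to the power q preserves weight and sends the Hermitian dual into the kernel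
of the generator matrix. -/
theorem minDistGE_hermitianDual_grl (hK : Module.finrank F K = 2) {n s k : ℕ} (hs : 1 ≤ s)
    (hsk : s ≤ k) {α v : Fin n → K} {A : Matrix (Fin s) (Fin s) K} (hα : Function.Injective α)
    (hv : ∀ j, v j ≠ 0) (hA : A.det ≠ 0) :
    MinDistGE (hermitianDual (Fintype.card F)
      (Submodule.span K (Set.range (grlMatrix k α v A)))) (k - s + 2) := by
  classical
  intro u hu hu0
  by_contra! hlt
  have hw0 : (fun i => u i ^ Fintype.card F) = 0 := by
    refine eq_zero_of_grlMatrix_mulVec_eq_zero hs hsk hα hv hA (w := fun i => u i ^ Fintype.card F)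
      ?_ ?_
    · have hnorm : hammingNorm (fun i => u i ^ Fintype.card F) = hammingNorm u := by
        simp [hammingNorm]
      rw [hnorm]
      convert! hlt
    · funext r
      have h := congrArg (FiniteField.frobeniusAlgHom F K)
        (hu _ (Submodule.subset_span (Set.mem_range_self r)))
      rw [map_sum, map_zero] at h
      rw [Matrix.mulVec, dotProduct, Pi.zero_apply, ← h]
      refine Finset.sum_congr rfl fun i _ => ?_
      rw [FiniteField.frobeniusAlgHom_apply, mul_pow, pow_card_pow_card hK, mul_comm]
  exact hu0 (funext fun i => eq_zero_of_pow_eq_zero (congrFun hw0 i))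

/-- Self-orthogonality may be checked on generators. -/
theorem isHermitianSelfOrthogonal_span {ι S : Type*} [Fintype ι] (g : S → ι → K)
    (h : ∀ r l, ∑ i, g r i * g l i ^ Fintype.card F = 0) :
    IsHermitianSelfOrthogonal (Fintype.card F) (Submodule.span K (Set.range g)) := by
  refine Submodule.span_le.2 ?_
  rintro _ ⟨r, rfl⟩ c hc
  have hF (x y : K) : (x + y) ^ Fintype.card F = x ^ Fintype.card F + y ^ Fintype.card F :=
    map_add (FiniteField.frobeniusAlgHom F K) x y
  induction hc using Submodule.span_induction with
  | mem x hx =>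
    obtain ⟨l, rfl⟩ := hx
    exact h r l
  | zero => simp [zero_pow Fintype.card_ne_zero]
  | add x y _ _ hx hy =>
    simp only [Pi.add_apply, hF, mul_add, Finset.sum_add_distrib, hx, hy, add_zero]
  | smul a x _ hx =>
    simp only [Pi.smul_apply, smul_eq_mul, mul_pow, mul_left_comm _ (a ^ Fintype.card F)]
    rw [← Finset.mul_sum, hx, mul_zero]

end Generalized_Roth_Lempel_codes

/-! ### Norms, the block A, the weights u, and Gram matrices over cosets. -/

section Construction

variable {F K : Type*} [Field F] [Fintype F] [Field K] [Algebra F K]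

theorem algebraMap_norm_eq_pow_card_add_one (hK : Module.finrank F K = 2) (x : K) :
    algebraMap F K (Algebra.norm F x) = x ^ (Fintype.card F + 1) := by
  have := finite_of_finrank_eq_two hK
  have hq := Fintype.one_lt_card (α := F)
  rw [FiniteField.algebraMap_norm_eq_pow, natCard_eq_sq hK, Nat.card_eq_fintype_card]
  congr 1
  refine Nat.div_eq_of_eq_mul_left (by omega) ?_
  rw [← Nat.sq_sub_sq, one_pow]

theorem exists_pow_card_add_one_eq (hK : Module.finrank F K = 2) (c : F) :
    ∃ x : K, x ^ (Fintype.card F + 1) = algebraMap F K c := by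
  have := finite_of_finrank_eq_two hK
  obtain ⟨x, hx⟩ := FiniteField.norm_surjective F K c
  exact ⟨x, by rw [← algebraMap_norm_eq_pow_card_add_one hK, hx]⟩

theorem exists_orderOf_pow_card_sub_one (hK : Module.finrank F K = 2) :
    ∃ g : Kˣ, orderOf (g ^ (Fintype.card F - 1)) = Fintype.card F + 1 := by
  have := finite_of_finrank_eq_two hK
  have hq := Fintype.one_lt_card (α := F)
  obtain ⟨g, hg⟩ := IsCyclic.exists_generator (α := Kˣ)
  have hcard : orderOf g = (Fintype.card F + 1) * (Fintype.card F - 1) := by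
    rw [orderOf_eq_card_of_forall_mem_zpowers hg, Nat.card_units, natCard_eq_sq hK,
      ← Nat.sq_sub_sq, one_pow]
  refine ⟨g, ?_⟩
  rw [orderOf_pow_of_dvd (by omega) (hcard ▸ dvd_mul_left _ _), hcard,
    Nat.mul_div_cancel _ (by omega)]

/-- The Hermitian form with anti-diagonal Gram matrix `(V, U, V ^ q)` is equivalent to the
standard one. -/
theorem exists_matrix_gram (hK : Module.finrank F K = 2) {U : F} (hU : U ≠ 0) {V : K}
    (hV : V ≠ 0) : ∃ A : Matrix (Fin 3) (Fin 3) K, A.det ≠ 0 ∧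
      ∀ i l, ∑ t, A i t * A l t ^ Fintype.card F =
        if (i : ℕ) + l = 2 then ![V, algebraMap F K U, V ^ Fintype.card F] i else 0 := by
  have hq := Fintype.one_lt_card (α := F)
  obtain ⟨t, ht⟩ := exists_pow_card_add_one_eq hK U
  obtain ⟨z, hz⟩ := exists_pow_card_add_one_eq hK (-1 : F)
  obtain ⟨g, hg⟩ := exists_orderOf_pow_card_sub_one hK
  set γ : K := ((g ^ (Fintype.card F - 1) : Kˣ) : K) with hγ
  have hγ1 : γ ≠ 1 := by
    rw [hγ, Units.val_eq_one.ne, ← orderOf_eq_one_iff.ne, hg]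
    omega
  have hγq : γ ^ (Fintype.card F + 1) = 1 := by
    rw [hγ, ← hg, ← Units.val_pow_eq_pow_val, pow_orderOf_eq_one, Units.val_one]
  rw [map_neg, map_one] at hz
  have hz0 : z ≠ 0 := by
    rintro rfl
    simp at hz
  have ht0 : t ≠ 0 := by
    rintro rfl
    rw [zero_pow (by omega), eq_comm, map_eq_zero] at ht
    exact hU ht
  have hne : 1 + z ^ Fintype.card F * (z * γ) ≠ 0 := by
    rw [← mul_assoc, ← pow_succ, hz]
    intro h0
    exact hγ1 (by linear_combination -h0)
  let φ := FiniteField.frobeniusAlgHom F K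
  have hφ (x : K) : φ x = x ^ Fintype.card F := rfl
  have hφφ (x : K) : φ (φ x) = x := pow_card_pow_card hK x
  have hzφ : z * φ z = -1 := by rw [hφ, ← pow_succ', hz]
  have hγφ : γ * φ γ = 1 := by rw [hφ, ← pow_succ', hγq]
  have htφ : t * φ t = algebraMap F K U := by rw [hφ, ← pow_succ', ht]
  let x : K := φ V / (1 + φ z * (z * γ))
  have hx : x * (1 + φ z * (z * γ)) = φ V := div_mul_cancel₀ _ hne
  have hx' : φ x * (1 + z * (φ z * φ γ)) = V := by
    have := congrArg φ hx
    simpa only [map_mul, map_add, map_one, hφφ] using this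
  have hx0 : x ≠ 0 := by
    intro h0
    rw [h0, map_zero, zero_mul] at hx'
    exact hV hx'.symm
  -- The outer rows are isotropic since N(z) = -1 and N(γ) = 1. As γ ≠ 1 they are independent with
  -- nonzero product, and x scales this product to V; t has norm U.
  refine ⟨!![1, 0, z; 0, t, 0; x, 0, x * (z * γ)], ?_, ?_⟩
  · rw [Matrix.det_fin_three]
    simp only [Matrix.of_apply, Matrix.cons_val', Matrix.cons_val_zero, Matrix.cons_val_one,
      Matrix.cons_val_fin_one, Matrix.cons_val]
    have : 1 * t * (x * (z * γ)) - 1 * 0 * 0 - 0 * 0 * (x * (z * γ)) + 0 * 0 * x + z * 0 * 0 -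
        z * t * x = t * x * z * (γ - 1) := by ring
    rw [this]
    exact mul_ne_zero (mul_ne_zero (mul_ne_zero ht0 hx0) hz0) (sub_ne_zero.2 hγ1)
  · simp only [← hφ]
    intro i l
    fin_cases i <;> fin_cases l <;> simp [Fin.sum_univ_three]
    · linear_combination hzφ
    · linear_combination hx'
    · exact htφ
    · linear_combination hx
    · linear_combination x * φ x * γ * φ γ * hzφ - x * φ x * hγφ

/-- Weights avoiding two linear conditions. -/
theorem exists_weights (hF : 4 ≤ Fintype.card F) {m : ℕ} (hm : 1 ≤ m) (γ : Fin m → K)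
    (hγ : ∀ s, γ s ≠ 0) : ∃ u : Fin m → F, (∀ s, u s ≠ 0) ∧ ∑ s, u s ≠ 0 ∧
      ∑ s, algebraMap F K (u s) * γ s ≠ 0 := by
  classical
  obtain ⟨m, rfl⟩ := Nat.exists_eq_add_of_le' hm
  obtain ⟨c₀, hc₀⟩ : ∃ c₀ : F, ∀ c : F,
      algebraMap F K c * γ 0 + ∑ s : Fin m, γ s.succ = 0 → c = c₀ := by
    by_cases h : ∃ c : F, algebraMap F K c * γ 0 + ∑ s : Fin m, γ s.succ = 0
    · obtain ⟨c₀, h₀⟩ := h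
      refine ⟨c₀, fun c hc => (algebraMap F K).injective (mul_right_cancel₀ (hγ 0) ?_)⟩
      exact add_right_cancel (hc.trans h₀.symm)
    · exact ⟨0, fun c hc => absurd ⟨c, hc⟩ h⟩
  -- All weights but the first are 1. The first must avoid 0 and one root of each linear condition:
  -- three values, hence 4 ≤ q.
  obtain ⟨c, -, hc⟩ := Finset.exists_mem_notMem_of_card_lt_card
    (s := {0, -(m : F), c₀}) (t := Finset.univ)
    (lt_of_le_of_lt Finset.card_le_three (by rw [Finset.card_univ]; omega))
  simp only [Finset.mem_insert, Finset.mem_singleton, not_or] at hc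
  refine ⟨Fin.cons c fun _ => 1, fun s => ?_, ?_, ?_⟩
  · refine Fin.cases ?_ (fun i => ?_) s
    · exact hc.1
    · exact one_ne_zero
  · intro h
    refine hc.2.1 (eq_neg_of_add_eq_zero_left ?_)
    simpa [Fin.sum_univ_succ] using h
  · intro h
    refine hc.2.2 (hc₀ c ?_)
    simpa [Fin.sum_univ_succ] using h

/-- The Hermitian inner products of the rows of a generalized Reed–Solomon code whose evaluation
set is a union of cosets of `Fˣ`. -/
theorem sum_coset_gram [DecidableEq F] {m κ : ℕ} (hκ : 2 ≤ κ) (hq : 2 * κ + 3 ≤ Fintype.card F)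
    (β : Fin m → K) (u : Fin m → F) (v : Fin m × Fˣ → K)
    (hv : ∀ s x, v (s, x) ^ (Fintype.card F + 1) =
      algebraMap F K (u s) * ((β s ^ (Fintype.card F + 1)) ^ κ)⁻¹ *
        algebraMap F K ((x : F) ^ (Fintype.card F - 1 - 2 * κ)))
    {i l : ℕ} (hi : i ≤ κ + 1) (hl : l ≤ κ + 1) :
    ∑ j : Fin m × Fˣ, v j * (β j.1 * algebraMap F K j.2) ^ i *
        (v j * (β j.1 * algebraMap F K j.2) ^ l) ^ Fintype.card F =
      if i + l = 2 * κ then -∑ s, algebraMap F K (u s) *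
        (((β s ^ (Fintype.card F + 1)) ^ κ)⁻¹ * β s ^ (i + Fintype.card F * l)) else 0 := by
  classical
  have hterm (s : Fin m) (x : Fˣ) : v (s, x) * (β s * algebraMap F K x) ^ i *
        (v (s, x) * (β s * algebraMap F K x) ^ l) ^ Fintype.card F =
      algebraMap F K (u s) *
        (((β s ^ (Fintype.card F + 1)) ^ κ)⁻¹ * β s ^ (i + Fintype.card F * l)) *
        algebraMap F K (((x ^ (Fintype.card F - 1 - 2 * κ + i + l) : Fˣ) : F)) := by
    have hx : algebraMap F K x ^ Fintype.card F = algebraMap F K x := by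
      rw [← map_pow, FiniteField.pow_card]
    have hxl : (algebraMap F K x ^ l) ^ Fintype.card F = algebraMap F K x ^ l := by
      rw [← pow_mul, mul_comm, pow_mul, hx]
    calc _ = v (s, x) ^ (Fintype.card F + 1) * (β s ^ (i + Fintype.card F * l)) *
          (algebraMap F K x ^ i * (algebraMap F K x ^ l) ^ Fintype.card F) := by ring
      _ = _ := by
        rw [hxl, hv]
        push_cast
        ring
  rw [Fintype.sum_prod_type]
  simp only [hterm, ← Finset.mul_sum, ← map_sum, ← Finset.sum_mul]
  simp only [Units.val_pow_eq_pow_val, FiniteField.sum_pow_units]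
  -- The exponent lies between 2 and q + 1 < 2(q - 1), so q - 1 is the only possible multiple.
  have hdvd : Fintype.card F - 1 ∣ Fintype.card F - 1 - 2 * κ + i + l ↔ i + l = 2 * κ := by
    constructor
    · intro h
      obtain ⟨c, hc⟩ := h
      have hc1 : c = 1 := by
        have h0 : 0 < c := by
          rw [Nat.pos_iff_ne_zero]
          rintro rfl
          omega
        have h2 : c < 2 := by
          by_contra! h2
          have := Nat.mul_le_mul_left (Fintype.card F - 1) h2
          omega
        omega
      rw [hc1, mul_one] at hc
      omega
    · intro h
      exact ⟨1, by omega⟩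
  simp only [hdvd]
  split_ifs <;> simp

end Construction

/-! ### Assembly of the self-orthogonal generator matrix. -/

section Self_orthogonal_codes

variable {K : Type*} [Field K]

/-- With κ = c + 1, this and the next two lemmas evaluate the coefficient of u_s in the three
surviving Gram entries. -/
theorem inv_pow_mul_pow_left {B : K} (hB : B ≠ 0) {c q : ℕ} (hq : 1 ≤ q) :
    ((B ^ (q + 1)) ^ (c + 1))⁻¹ * B ^ (c + q * (c + 2)) =
      B ^ (q - 1) := by
  rw [inv_mul_eq_iff_eq_mul₀ (pow_ne_zero _ (pow_ne_zero _ hB)), ← pow_mul, ← pow_add]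
  congr 1
  obtain ⟨n, rfl⟩ := Nat.exists_eq_add_of_le' hq
  rw [Nat.add_sub_cancel]
  ring

theorem inv_pow_mul_pow_middle {B : K} (hB : B ≠ 0) {c q : ℕ} :
    ((B ^ (q + 1)) ^ (c + 1))⁻¹ * B ^ (c + 1 + q * (c + 1)) = 1 := by
  rw [inv_mul_eq_iff_eq_mul₀ (pow_ne_zero _ (pow_ne_zero _ hB))]
  ring

theorem inv_pow_mul_pow_right {B : K} (hB : B ≠ 0) {c q : ℕ} (hq : 1 ≤ q)
    (hBB : (B ^ q) ^ q = B) :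
    ((B ^ (q + 1)) ^ (c + 1))⁻¹ * B ^ (c + 2 + q * c) =
      (B ^ (q - 1)) ^ q := by
  rw [inv_mul_eq_iff_eq_mul₀ (pow_ne_zero _ (pow_ne_zero _ hB))]
  calc B ^ (c + 2 + q * c) = B ^ (c + 1 + q * c) * B := by ring
    _ = B ^ (c + 1 + q * c) * (B ^ q) ^ q := by rw [hBB]
    _ = _ := by
      simp only [← pow_mul, ← pow_add]
      congr 1
      obtain ⟨n, rfl⟩ := Nat.exists_eq_add_of_le' hq
      rw [Nat.add_sub_cancel]
      ring

variable {F : Type*} [Field F] [Fintype F] [Algebra F K]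

/-- A Hermitian self-orthogonal generator matrix of a generalized Roth–Lempel code whose
evaluation set is a union of `m` cosets of `Fˣ`. -/
theorem exists_selfOrthogonal_grl (hK : Module.finrank F K = 2) {m k : ℕ}
    (hq : 5 ≤ Fintype.card F) (hm : 1 ≤ m) (hm' : m ≤ Fintype.card F + 1) (hk : 4 ≤ k)
    (hk' : 2 * k ≤ Fintype.card F + 1) :
    ∃ (α v : Fin (m * (Fintype.card F - 1)) → K) (A : Matrix (Fin 3) (Fin 3) K),
      Function.Injective α ∧ (∀ j, v j ≠ 0) ∧ A.det ≠ 0 ∧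
        IsHermitianSelfOrthogonal (Fintype.card F)
          (Submodule.span K (Set.range (grlMatrix k α v A))) := by
  classical
  obtain ⟨κ, rfl⟩ := Nat.exists_eq_add_of_le' (show 2 ≤ k by omega)
  obtain ⟨g, hg⟩ := exists_orderOf_pow_card_sub_one (F := F) (K := K) hK
  let β : Fin m → K := fun s => (g : K) ^ (s : ℕ)
  have hβ (s) : β s ≠ 0 := pow_ne_zero _ g.ne_zero
  have hββ (s) : (β s ^ Fintype.card F) ^ Fintype.card F = β s := pow_card_pow_card hK _
  -- The map y ↦ y^(q-1) is trivial on Fˣ, so it separates the cosets; its values here are distinct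
  -- powers of an element of order q + 1 ≥ m.
  have hβinj : Function.Injective fun s => β s ^ (Fintype.card F - 1) := by
    intro s s' h
    have h' : (g ^ (Fintype.card F - 1)) ^ (s : ℕ) = (g ^ (Fintype.card F - 1)) ^ (s' : ℕ) := by
      ext
      simpa [β, ← pow_mul, mul_comm] using h
    exact Fin.ext (pow_injOn_Iio_orderOf (Set.mem_Iio.2 (by omega))
      (Set.mem_Iio.2 (by omega)) h')
  obtain ⟨u, hu, hU, hV⟩ := exists_weights (F := F) (by omega) hm
    (fun s => β s ^ (Fintype.card F - 1)) fun s => pow_ne_zero _ (hβ s)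
  obtain ⟨A, hA, hgram⟩ := exists_matrix_gram hK hU hV
  have hvex (j : Fin m × Fˣ) : ∃ v : K, v ^ (Fintype.card F + 1) =
      algebraMap F K (u j.1) * ((β j.1 ^ (Fintype.card F + 1)) ^ κ)⁻¹ *
        algebraMap F K ((j.2 : F) ^ (Fintype.card F - 1 - 2 * κ)) := by
    obtain ⟨v, hv⟩ := exists_pow_card_add_one_eq hK
      (u j.1 * (Algebra.norm F (β j.1) ^ κ)⁻¹ * (j.2 : F) ^ (Fintype.card F - 1 - 2 * κ))
    refine ⟨v, ?_⟩
    rw [hv, map_mul, map_mul, map_inv₀, map_pow (algebraMap F K) (Algebra.norm F (β j.1)),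
      algebraMap_norm_eq_pow_card_add_one hK]
  choose v hv using hvex
  let σ : Fin (m * (Fintype.card F - 1)) ≃ Fin m × Fˣ := finProdFinEquiv.symm.trans
    (Equiv.prodCongr (Equiv.refl _) (Fintype.equivFinOfCardEq (Fintype.card_units F)).symm)
  refine ⟨fun j => β (σ j).1 * algebraMap F K (σ j).2, fun j => v (σ j), A, ?_, ?_, hA, ?_⟩
  · intro j j' h
    refine σ.injective ?_
    have hpow := congrArg (· ^ (Fintype.card F - 1)) h
    simp only [mul_pow, ← map_pow, FiniteField.pow_card_sub_one_eq_one _ (Units.ne_zero _),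
      map_one, mul_one] at hpow
    have h1 : (σ j).1 = (σ j').1 := hβinj hpow
    refine Prod.ext h1 (Units.ext ((algebraMap F K).injective (mul_left_cancel₀ (hβ (σ j).1) ?_)))
    simpa [h1] using h
  · intro j h0
    have := hv (σ j)
    beta_reduce at h0
    rw [h0, zero_pow (by omega), eq_comm] at this
    simp [hu, hβ] at this
  · refine isHermitianSelfOrthogonal_span _ fun r l => ?_
    have hleft := sum_coset_gram (by omega) (by omega) β u v (fun s x => hv (s, x))
      (Nat.le_of_lt_succ r.2) (Nat.le_of_lt_succ l.2)
    rw [← σ.sum_comp] at hleft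
    rw [Fintype.sum_sum_type]
    simp only [grlMatrix, Matrix.of_apply]
    rw [hleft]
    by_cases hr : κ + 2 - 3 ≤ (r : ℕ)
    · by_cases hl : κ + 2 - 3 ≤ (l : ℕ)
      · simp only [dif_pos hr, dif_pos hl, hgram]
        -- The antidiagonal of the Gram matrix of A meets exactly the surviving entries of the left
        -- block, with opposite values.
        have hiff : (r : ℕ) - (κ + 2 - 3) + (l - (κ + 2 - 3)) = 2 ↔ (r : ℕ) + l = 2 * κ := by
          omega
        simp only [hiff]
        split_ifs with h
        · rw [neg_add_eq_zero]
          obtain ⟨c, rfl⟩ := Nat.exists_eq_add_of_le' (show 1 ≤ κ by omega)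
          obtain hr' | hr' | hr' : (r : ℕ) = c ∨ (r : ℕ) = c + 1 ∨ (r : ℕ) = c + 2 := by omega
          · have hi : (⟨(r : ℕ) - (c + 1 + 2 - 3), by omega⟩ : Fin 3) = 0 := Fin.ext (by simp; omega)
            rw [hi, hr', show (l : ℕ) = c + 2 by omega]
            exact Finset.sum_congr rfl fun s _ => by rw [inv_pow_mul_pow_left (hβ s) (by omega)]
          · have hi : (⟨(r : ℕ) - (c + 1 + 2 - 3), by omega⟩ : Fin 3) = 1 := Fin.ext (by simp; omega)
            rw [hi, hr', show (l : ℕ) = c + 1 by omega]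
            simp only [inv_pow_mul_pow_middle (hβ _), mul_one, ← map_sum]
            rfl
          · have hi : (⟨(r : ℕ) - (c + 1 + 2 - 3), by omega⟩ : Fin 3) = 2 := Fin.ext (by simp; omega)
            rw [hi, hr', show (l : ℕ) = c by omega]
            refine Eq.trans ?_ (map_sum (FiniteField.frobeniusAlgHom F K) _ _).symm
            refine Finset.sum_congr rfl fun s _ => ?_
            rw [inv_pow_mul_pow_right (hβ s) (by omega) (hββ s), map_mul, AlgHom.commutes,
              FiniteField.frobeniusAlgHom_apply]
        · simp
      · rw [if_neg (by omega)]
        simp only [dif_neg hl, zero_pow Fintype.card_ne_zero, mul_zero, Finset.sum_const_zero,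
          add_zero]
    · rw [if_neg (by omega)]
      simp only [dif_neg hr, zero_mul, Finset.sum_const_zero, add_zero]

end Self_orthogonal_codes

end QuantumGRL

/-! ### The main theorem, with s = 3 giving the bound (k - 3) + 2 = k - 1. -/

theorem mainTheorem11 {F K : Type*} [Field F] [Fintype F] [Field K] [Algebra F K]
    (hK : Module.finrank F K = 2)
    (p : ℕ) [Fact p.Prime] [Algebra (ZMod p) F]
    (ω : ℂ) (hω : IsPrimitiveRoot ω p)
    (q m k : ℕ) (hF : Fintype.card F = q) (hq : 5 ≤ q)
    (hm : 2 ≤ m) (hm' : m ≤ q + 1) (hk : 4 ≤ k) (hk' : 2 * k ≤ q + 1) :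
    ∃ C : Submodule K (Fin (m * (q - 1)) ⊕ Fin 3 → K),
      QuantumGRL.IsGRLCode (m * (q - 1)) 3 k C ∧
      QuantumGRL.IsHermitianSelfOrthogonal q C ∧
      Module.finrank K C = k ∧
      QuantumGRL.MinDistGE C (m * (q - 1) - k + 2) ∧
      ∃ Q : Submodule ℂ (QuantumGRL.QuditSpace F (Fin (m * (q - 1)) ⊕ Fin 3)),
        QuantumGRL.IsStabilizerCodeOf p ω C Q ∧
        ∃ d : ℕ, k - 1 ≤ d ∧
          QuantumGRL.IsQuantumCode p ω Q (m * (q - 1) + 3) (m * (q - 1) + 3 - 2 * k) d := by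
  subst hF
  have hn : 2 * (Fintype.card F - 1) ≤ m * (Fintype.card F - 1) := Nat.mul_le_mul_right _ hm
  have hkn : k ≤ m * (Fintype.card F - 1) := by omega
  obtain ⟨α, v, A, hα, hv, hA, hself⟩ :=
    QuantumGRL.exists_selfOrthogonal_grl hK hq (by omega) hm' hk hk'
  have hfinrank := QuantumGRL.finrank_grl (k := k) (by omega) (by omega) hkn hα hv hA
  have hdual := QuantumGRL.minDistGE_hermitianDual_grl hK (k := k) (by omega) (by omega) hα hv hA
  have hcard : Fintype.card (Fin (m * (Fintype.card F - 1)) ⊕ Fin 3) =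
      m * (Fintype.card F - 1) + 3 := by simp
  obtain ⟨Q, hQ, d, hd, hcode⟩ := QuantumGRL.exists_stabilizerCode p hK hω hself
    (by rw [hfinrank, hcard]; omega) hdual
  rw [hfinrank, hcard] at hcode
  exact ⟨_, ⟨by omega, hkn, α, v, A, hα, hv, hA, rfl⟩, hself, hfinrank,
    QuantumGRL.minDistGE_grl (by omega) (by omega) hkn hα hv hA, Q, hQ, d, by omega, hcode⟩
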